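/- Let $P$ be a finite partially ordered set with $d$ elements $y_1,\dots,y_d$, and let $\hat P = P\cup\{\hat 0,\hat 1\}$ be obtained by adjoining a new least element $\hat 0$ and a new greatest element $\hat 1$. For each covering relation $a\lessdot b$ of $\hat P$ (an edge of its Hasse diagram) put $\rho(a,b)=u(a)-u(b)\in\mathbb{R}^d$, where $u(y_i)=\mathbf{e}_i$ is the $i$-th unit vector and $u(\hat 0)=u(\hat 1)=0$. Let $\mathcal{Q}_P\subset\mathbb{R}^d$ be the convex hull of all the vectors $\rho(a,b)$. A Fano polytope in $\mathbb{R}^d$ is a $d$-dimensional convex polytope all of whose vertices have integer coordinates and whose unique integer point in the interior is the origin. It is called $\mathbb{Q}$-factorial if each of its proper faces is a simplex, and smooth if the vertices of each facet form a $\mathbb{Z}$-basis of $\mathbb{Z}^d$. Suppose that $P$ is pure, i.e. all maximal chains of $\hat P$ have the same length. Then the following conditions are equivalent: (i) $\mathcal{Q}_P$ is a $\mathbb{Q}$-factorial Fano polytope; (ii) $\mathcal{Q}_P$ is a smooth Fano polytope; (iii) $P$ is, as a partially ordered set, a disjoint union of chains (elements of different chains being incomparable). -/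

import Mathlib

universe u v

namespace FanoPoset

section Polytopes

variable {ι : Type v}

/-- The integer points of `ℝ^ι`. -/
def IsIntegerPoint (x : ι → ℝ) : Prop := ∃ z : ι → ℤ, x = fun i => (z i : ℝ)

/-- The vertices of a convex polytope are its extreme points. -/
def vertices (Q : Set (ι → ℝ)) : Set (ι → ℝ) := Q.extremePoints ℝ

/-- Convex polytopes: convex hulls of finite sets. -/
def IsPolytope (Q : Set (ι → ℝ)) : Prop :=
  ∃ s : Set (ι → ℝ), s.Finite ∧ Q = convexHull ℝ s

/-- Integral (lattice) polytopes: all vertices have integer coordinates. -/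
def IsIntegralPolytope (Q : Set (ι → ℝ)) : Prop :=
  IsPolytope Q ∧ ∀ v ∈ vertices Q, IsIntegerPoint v

/-- The dimension of (the affine hull of) a nonempty set. -/
noncomputable def dimension (Q : Set (ι → ℝ)) : ℕ := Module.finrank ℝ (vectorSpan ℝ Q)

/-- Fano polytopes in `ℝ^ι`: full-dimensional integral polytopes whose unique interior integer
point is the origin. -/
def IsFano [Fintype ι] (Q : Set (ι → ℝ)) : Prop :=
  IsIntegralPolytope Q ∧ dimension Q = Fintype.card ι ∧
    {x | x ∈ interior Q ∧ IsIntegerPoint x} = {0}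

/-- Proper nonempty faces of `Q`: the subsets on which some linear functional attains its maximum
over `Q`, other than `Q` itself. -/
def IsProperFace (Q F : Set (ι → ℝ)) : Prop :=
  IsExposed ℝ Q F ∧ F.Nonempty ∧ F ≠ Q

/-- Facets: faces of codimension one in `Q`. -/
def IsFacet (Q F : Set (ι → ℝ)) : Prop :=
  IsProperFace Q F ∧ dimension F + 1 = dimension Q

/-- Simplices (of any dimension `n`): convex hulls of `n + 1` affinely independent points. -/
def IsSimplex (F : Set (ι → ℝ)) : Prop :=
  ∃ (n : ℕ) (S : Affine.Simplex ℝ (ι → ℝ) n), F = convexHull ℝ (Set.range S.points)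

/-- `ℚ`-factorial Fano polytopes: simplicial Fano polytopes. -/
def IsQFactorialFano [Fintype ι] (Q : Set (ι → ℝ)) : Prop :=
  IsFano Q ∧ ∀ F, IsProperFace Q F → IsSimplex F

/-- Smooth Fano polytopes: the vertices of each facet form a `ℤ`-basis of `ℤ^ι`. -/
def IsSmoothFano [Fintype ι] (Q : Set (ι → ℝ)) : Prop :=
  IsFano Q ∧ ∀ F, IsFacet Q F →
    ∃ b : Module.Basis ι ℤ (ι → ℤ),
      vertices F = Set.range (fun k => (fun i => (b k i : ℝ) : ι → ℝ))

end Polytopes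

section Posets

variable (P : Type u) [PartialOrder P]

/-- `P̂`, the poset `P` with a new least element `⊥` and a new greatest element `⊤`. -/
abbrev Hat : Type u := WithBot (WithTop P)

variable {P} in
/-- The unit vector of an element of `P`; the zero vector for the added elements `⊥` and `⊤`. -/
noncomputable def unitVec (a : Hat P) : P → ℝ := by
  classical
  exact fun y => if a = ((y : WithTop P) : WithBot (WithTop P)) then 1 else 0

variable {P} in
/-- The vector `ρ(e)` of an edge `e = {a, b}` with `a < b`: it is `e_a` if `b = ⊤`, it is `-e_b`
if `a = ⊥`, and `e_a - e_b` if both ends lie in `P`. -/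
noncomputable def rho (a b : Hat P) : P → ℝ := unitVec a - unitVec b

/-- The polytope `𝒬_P`: the convex hull of the vectors `ρ(e)` over all edges `e` of the Hasse
diagram of `P̂`. -/
def polytope : Set (P → ℝ) :=
  convexHull ℝ {x | ∃ a b : Hat P, a ⋖ b ∧ x = rho a b}

/-- `P` is pure: all maximal chains of `P̂` have the same length, i.e. the same number of
elements (the length of a chain is this number minus one). -/
def IsPure : Prop :=
  ∀ C D : Set (Hat P), IsMaxChain (· ≤ ·) C → IsMaxChain (· ≤ ·) D → C.ncard = D.ncard

/-- `P` is, as a poset, a disjoint union of chains: it is order isomorphic to a disjoint sum of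
linear orders, where elements of different summands are incomparable. -/
def IsDisjointUnionOfChains : Prop :=
  ∃ (ι : Type u) (C : ι → Type u) (_ : ∀ i, LinearOrder (C i)), Nonempty (P ≃o (Σ i, C i))

end Posets

end FanoPoset

/-! A linear functional `l` is the same as a potential `h` on `Hat P` with `h ⊥ = h ⊤ = 0`, and then
`l (rho a b) = h a - h b`. If `l` is nonpositive on all edges, `h` increases from 0 to 0 and so
vanishes (`eq_zero_of_nonpos_on_edgeVectors`). Hence 0 is interior, and since the polytope lies in
the cube `[-1, 1]^P` it is always Fano. Proper faces are the hulls of the "tight" edges, those with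
`l = M`, for a supporting `l` with maximum `M > 0`; for nonempty `P` every edge vector is a vertex.

Conditions (i) and (ii) both make the vertices of each facet linearly independent, hence also the
tight edges of any supporting functional, since each face lies in a facet. Purity gives a rank
function. If `x` has two upper covers in `P`, the potential that is corank above `x` and 0 elsewhere
makes all edges above `x` tight; two paths from `x` to `⊤` then both sum to `e_x`, a linear
relation. Lower covers are dual. So covers in `P` are unique on both sides, and `P` is a disjoint
union of chains.

Conversely, in a disjoint union of chains the sum of coordinates over an interval `[b, p]` vanishes
on every edge except the one entering `b` and the one leaving `p`. A tight edge always has a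
non-tight edge above or below it, because a path from `⊥` to `⊤` sums to 0; the interval between the
two gives a functional isolating the tight edge. So faces are simplices. On a facet the tight edges
span, so no `v` has non-tight edges both above and below; `e_v` is thus an integer combination of
tight edges, which gives smoothness. -/

namespace FanoPoset

/-! ### Order theory of `Hat P` and of disjoint unions of chains -/

section Order

variable {P : Type u} [PartialOrder P]

/-- The inclusion of `P` in `P̂`. -/
def toHat (x : P) : Hat P := ((x : WithTop P) : WithBot (WithTop P))

@[simp] theorem toHat_le_toHat {x y : P} : toHat x ≤ toHat y ↔ x ≤ y := by
  simp [toHat]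

omit [PartialOrder P] in
@[simp] theorem toHat_inj {x y : P} : toHat x = toHat y ↔ x = y := by
  simp [toHat]

omit [PartialOrder P] in
@[simp] theorem toHat_ne_bot (x : P) : toHat x ≠ ⊥ := by simp [toHat]

omit [PartialOrder P] in
@[simp] theorem toHat_ne_top (x : P) : toHat x ≠ ⊤ := by
  intro h
  have : ((x : WithTop P) : WithBot (WithTop P)) = ((⊤ : WithTop P) : WithBot (WithTop P)) := h
  simp at this

omit [PartialOrder P] in
theorem hat_cases (a : Hat P) : a = ⊥ ∨ a = ⊤ ∨ ∃ x : P, a = toHat x := by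
  induction a using WithBot.recBotCoe with
  | bot => exact Or.inl rfl
  | coe a =>
    induction a using WithTop.recTopCoe with
    | top => exact Or.inr (Or.inl rfl)
    | coe a => exact Or.inr (Or.inr ⟨a, rfl⟩)

omit [PartialOrder P] in
theorem exists_eq_toHat {a : Hat P} (hb : a ≠ ⊥) (ht : a ≠ ⊤) : ∃ x : P, a = toHat x := by
  rcases hat_cases a with h | h | h
  · exact absurd h hb
  · exact absurd h ht
  · exact h

theorem toHat_covBy_toHat {x y : P} : toHat x ⋖ toHat y ↔ x ⋖ y := by
  simp only [toHat, WithBot.coe_covBy_coe, WithTop.coe_covBy_coe]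

omit [PartialOrder P] in
theorem bot_ne_top_hat : (⊥ : Hat P) ≠ ⊤ := by
  intro h
  exact WithBot.bot_ne_coe (a := (⊤ : WithTop P)) h

/-- Upward and downward induction along covering relations in a finite bounded order. -/
theorem induction_down {α : Type*} [PartialOrder α] [OrderTop α] [Finite α] {p : α → Prop} {a : α}
    (top : p ⊤) (step : ∀ x y, a ≤ x → x ⋖ y → p y → p x) : ∀ x, a ≤ x → p x := by
  intro x
  induction x using (wellFounded_gt (α := α)).induction with
  | _ x ih =>
    intro hx
    rcases eq_or_ne x ⊤ with rfl | h
    · exact top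
    · obtain ⟨y, hxy, -⟩ := exists_covBy_le_of_lt h.lt_top
      exact step x y hx hxy (ih y hxy.lt (hx.trans hxy.le))

theorem induction_up {α : Type*} [PartialOrder α] [OrderBot α] [Finite α] {p : α → Prop} {a : α}
    (bot : p ⊥) (step : ∀ x y, y ≤ a → x ⋖ y → p x → p y) : ∀ x, x ≤ a → p x := by
  intro x
  induction x using (wellFounded_lt (α := α)).induction with
  | _ x ih =>
    intro hx
    rcases eq_or_ne x ⊥ with rfl | h
    · exact bot
    · obtain ⟨y, -, hxy⟩ := exists_le_covBy_of_lt h.bot_lt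
      exact step y x hx hxy (ih y hxy.lt (hxy.le.trans hx))

theorem IsDisjointUnionOfChains.le_total (h : IsDisjointUnionOfChains P) {x a b : P}
    (hab : (x ≤ a ∧ x ≤ b) ∨ (a ≤ x ∧ b ≤ x)) : a ≤ b ∨ b ≤ a := by
  obtain ⟨ι, C, inst, ⟨e⟩⟩ := h
  rw [← e.le_iff_le, ← e.le_iff_le (x := x) (y := b), ← e.le_iff_le (x := a) (y := x),
    ← e.le_iff_le (x := b) (y := x)] at hab
  rw [← e.le_iff_le, ← e.le_iff_le (x := b)]
  generalize e a = a' at *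
  generalize e b = b' at *
  generalize e x = x' at *
  obtain ⟨i, a'⟩ := a'
  obtain ⟨j, b'⟩ := b'
  obtain ⟨k, x'⟩ := x'
  simp only [Sigma.le_def] at hab
  have hk : i = j := by
    rcases hab with ⟨⟨h1, -⟩, ⟨h2, -⟩⟩ | ⟨⟨h1, -⟩, ⟨h2, -⟩⟩
    · exact h1.symm.trans h2
    · exact h1.trans h2.symm
  subst hk
  simp only [Sigma.mk_le_mk_iff]
  exact _root_.le_total a' b'

theorem IsDisjointUnionOfChains.hat_le_total (h : IsDisjointUnionOfChains P) {x : P} {a b : Hat P}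
    (hab : (toHat x ≤ a ∧ toHat x ≤ b) ∨ (a ≤ toHat x ∧ b ≤ toHat x)) : a ≤ b ∨ b ≤ a := by
  rcases hat_cases a with rfl | rfl | ⟨a, rfl⟩
  · simp
  · simp
  rcases hat_cases b with rfl | rfl | ⟨b, rfl⟩
  · simp
  · simp
  simp only [toHat_le_toHat] at hab ⊢
  exact h.le_total hab

theorem IsDisjointUnionOfChains.upper_cover_unique (h : IsDisjointUnionOfChains P) {x : P}
    {a b : Hat P} (ha : toHat x ⋖ a) (hb : toHat x ⋖ b) : a = b := by
  rcases h.hat_le_total (Or.inl ⟨ha.le, hb.le⟩) with hab | hab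
  · exact (hb.eq_or_eq ha.le hab).resolve_left ha.ne'
  · exact ((ha.eq_or_eq hb.le hab).resolve_left hb.ne').symm

theorem IsDisjointUnionOfChains.lower_cover_unique (h : IsDisjointUnionOfChains P) {x : P}
    {a b : Hat P} (ha : a ⋖ toHat x) (hb : b ⋖ toHat x) : a = b := by
  rcases h.hat_le_total (Or.inr ⟨ha.le, hb.le⟩) with hab | hab
  · exact ((ha.eq_or_eq hab hb.le).resolve_right hb.ne).symm
  · exact ((hb.eq_or_eq hab ha.le).resolve_right ha.ne)

/-- Downward induction on `x`: strict upper bounds `a` and `b` both lie above the unique upper cover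
of `x`. -/
theorem le_total_of_upper_cover_unique [Finite P]
    (h : ∀ x a b : P, x ⋖ a → x ⋖ b → a = b) : ∀ x a b : P, x ≤ a → x ≤ b → a ≤ b ∨ b ≤ a := by
  intro x
  induction x using (wellFounded_gt (α := P)).induction with
  | _ x ih =>
    intro a b ha hb
    rcases ha.eq_or_lt with rfl | ha
    · exact Or.inl hb
    rcases hb.eq_or_lt with rfl | hb
    · exact Or.inr ha.le
    obtain ⟨a', ha1, ha2⟩ := exists_covBy_le_of_lt ha
    obtain ⟨b', hb1, hb2⟩ := exists_covBy_le_of_lt hb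
    obtain rfl := h x a' b' ha1 hb1
    exact ih a' ha1.lt a b ha2 hb2

theorem le_total_of_lower_cover_unique [Finite P]
    (h : ∀ x a b : P, a ⋖ x → b ⋖ x → a = b) : ∀ x a b : P, a ≤ x → b ≤ x → a ≤ b ∨ b ≤ a := by
  intro x
  induction x using (wellFounded_lt (α := P)).induction with
  | _ x ih =>
    intro a b ha hb
    rcases ha.eq_or_lt with rfl | ha
    · exact Or.inr hb
    rcases hb.eq_or_lt with rfl | hb
    · exact Or.inl ha.le
    obtain ⟨a', ha1, ha2⟩ := exists_le_covBy_of_lt ha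
    obtain ⟨b', hb1, hb2⟩ := exists_le_covBy_of_lt hb
    obtain rfl := h x a' b' ha2 hb2
    exact ih a' ha2.lt a b ha1 hb1

/-- Unique covers make comparability transitive, hence an equivalence relation; its classes are the
chains. -/
theorem isDisjointUnionOfChains_of_cover_unique [Finite P]
    (hu : ∀ x a b : P, x ⋖ a → x ⋖ b → a = b) (hl : ∀ x a b : P, a ⋖ x → b ⋖ x → a = b) :
    IsDisjointUnionOfChains P := by
  classical
  have hu := le_total_of_upper_cover_unique hu
  have hl := le_total_of_lower_cover_unique hl
  let s : Setoid P :=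
    { r := fun a b => a ≤ b ∨ b ≤ a
      iseqv :=
        { refl := fun a => Or.inl le_rfl
          symm := fun h => h.symm
          trans := by
            rintro a b c (hab | hab) (hbc | hbc)
            · exact Or.inl (hab.trans hbc)
            · exact hl b a c hab hbc
            · exact hu b a c hab hbc
            · exact Or.inr (hbc.trans hab) } }
  refine ⟨Quotient s, fun i => {x : P // (Quotient.mk s x) = i}, fun i =>
    { (inferInstance : PartialOrder {x : P // (Quotient.mk s x) = i}) with
      le_total := fun a b => Quotient.exact (a.2.trans b.2.symm)
      toDecidableLE := Classical.decRel _ }, ⟨?_⟩⟩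
  refine
    { toEquiv := (Equiv.sigmaFiberEquiv (Quotient.mk s)).symm
      map_rel_iff' := ?_ }
  intro a b
  constructor
  · intro h
    obtain ⟨h1, h2⟩ := Sigma.le_def.1 h
    change Quotient.mk s a = Quotient.mk s b at h1
    -- The transport in the sigma order disappears once the two class indices are generalised and
    -- identified.
    have key : ∀ (i j : Quotient s) (hij : i = j) (ha : Quotient.mk s a = i)
        (hb : Quotient.mk s b = j),
        (hij.rec (motive := fun k _ => {x : P // Quotient.mk s x = k}) ⟨a, ha⟩).1 ≤ b → a ≤ b := by
      rintro i j rfl ha hb h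
      exact h
    exact key _ _ h1 rfl rfl h2
  · intro h
    have h1 : Quotient.mk s a = Quotient.mk s b := Quotient.sound (Or.inl h)
    have key : ∀ (i j : Quotient s) (hij : i = j) (ha : Quotient.mk s a = i)
        (hb : Quotient.mk s b = j),
        (hij.rec (motive := fun k _ => {x : P // Quotient.mk s x = k}) ⟨a, ha⟩).1 ≤ b := by
      rintro i j rfl ha hb
      exact h
    exact Sigma.le_def.2 ⟨h1, key _ _ h1 rfl rfl⟩

end Order

/-! ### Equal-length maximal chains give a rank function -/

section Rank

variable {α : Type*} [PartialOrder α]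

/-- An element `y ≥ a` comparable to the upper part of `D` is comparable to all of `D`, whose
remaining elements are below `a`; so maximality of `D` applies. Below `a` the same works with `C`.
-/
theorem IsMaxChain.splice {C D : Set α} (hC : IsMaxChain (· ≤ ·) C) (hD : IsMaxChain (· ≤ ·) D)
    {a : α} (haC : a ∈ C) (haD : a ∈ D) :
    IsMaxChain (· ≤ ·) ((C ∩ Set.Iio a) ∪ (D ∩ Set.Ici a)) := by
  have hchain : IsChain (· ≤ ·) ((C ∩ Set.Iio a) ∪ (D ∩ Set.Ici a)) := by
    rintro x (⟨hx, hxa⟩ | ⟨hx, hxa⟩) y (⟨hy, hya⟩ | ⟨hy, hya⟩) hxy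
    · exact hC.1 hx hy hxy
    · exact Or.inl ((Set.mem_Iio.1 hxa).le.trans hya)
    · exact Or.inr ((Set.mem_Iio.1 hya).le.trans hxa)
    · exact hD.1 hx hy hxy
  refine ⟨hchain, fun F hF hsub => hsub.antisymm fun y hy => ?_⟩
  have haF : a ∈ F := hsub (Or.inr ⟨haD, le_rfl⟩)
  have hmem : ∀ {G : Set α}, IsMaxChain (· ≤ ·) G → (∀ z ∈ G, y ≤ z ∨ z ≤ y) → y ∈ G := by
    intro G hG h
    have := hG.2 (hG.1.insert (a := y) fun b hb _ => h b hb) (Set.subset_insert y G)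
    rw [this]
    exact Set.mem_insert y G
  by_cases hya : a ≤ y
  · refine Or.inr ⟨hmem hD fun z hz => ?_, hya⟩
    rcases hD.1.total hz haD with hza | hza
    · exact Or.inr (hza.trans hya)
    · exact hF.total hy (hsub (Or.inr ⟨hz, hza⟩))
  · have hya' : y ≤ a := (hF.total hy haF).resolve_right hya
    have hlt : y < a := lt_of_le_not_ge hya' hya
    refine Or.inl ⟨hmem hC fun z hz => ?_, hlt⟩
    rcases hC.1.total hz haC with hza | hza
    · rcases hza.eq_or_lt with rfl | hza
      · exact Or.inl hya'
      · exact hF.total hy (hsub (Or.inl ⟨hz, hza⟩))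
    · exact Or.inl (hya'.trans hza)

theorem exists_isMaxChain_superset {s : Set α} (hs : IsChain (· ≤ ·) s) :
    ∃ C, IsMaxChain (· ≤ ·) C ∧ s ⊆ C := by
  obtain ⟨M, hM, hsM⟩ := hs.exists_maxChain
  exact ⟨M, hM, hsM⟩

theorem ncard_inter_Iio_eq [Finite α]
    (h : ∀ C D : Set α, IsMaxChain (· ≤ ·) C → IsMaxChain (· ≤ ·) D → C.ncard = D.ncard)
    {C D : Set α} (hC : IsMaxChain (· ≤ ·) C) (hD : IsMaxChain (· ≤ ·) D)
    {a : α} (haC : a ∈ C) (haD : a ∈ D) :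
    (C ∩ Set.Iio a).ncard = (D ∩ Set.Iio a).ncard := by
  have h1 : ∀ X Y : Set α, ((X ∩ Set.Iio a) ∪ (Y ∩ Set.Ici a)).ncard =
      (X ∩ Set.Iio a).ncard + (Y ∩ Set.Ici a).ncard := by
    intro X Y
    refine Set.ncard_union_eq ?_ (Set.toFinite _) (Set.toFinite _)
    rw [Set.disjoint_left]
    rintro x ⟨-, hx⟩ ⟨-, hx'⟩
    exact absurd (Set.mem_Iio.1 hx) (not_lt_of_ge hx')
  -- Both chains have the same part above `a`, so it cancels in the count.
  have h2 := h _ _ (IsMaxChain.splice hC hD haC haD) (IsMaxChain.splice hD hD haD haD)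
  rw [h1, h1] at h2
  omega

/-- A finite bounded order in which all maximal chains have the same size is graded. -/
theorem exists_rank [Finite α] [BoundedOrder α]
    (h : ∀ C D : Set α, IsMaxChain (· ≤ ·) C → IsMaxChain (· ≤ ·) D → C.ncard = D.ncard) :
    ∃ r : α → ℕ, r ⊥ = 0 ∧ (∀ a, r a ≤ r ⊤) ∧ ∀ a b, a ⋖ b → r b = r a + 1 := by
  choose C hC haC using fun a : α =>
    exists_isMaxChain_superset (IsChain.singleton (r := (· ≤ ·)) (a := a))
  have hr : ∀ {a : α} {D : Set α}, IsMaxChain (· ≤ ·) D → a ∈ D →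
      (C a ∩ Set.Iio a).ncard = (D ∩ Set.Iio a).ncard := fun {a D} hD ha =>
    ncard_inter_Iio_eq h (hC a) hD (haC a rfl) ha
  -- The rank counts the elements strictly below `a` in a maximal chain through `a`; by `hr` the
  -- choice of chain is irrelevant.
  refine ⟨fun a => (C a ∩ Set.Iio a).ncard, ?_, fun a => ?_, fun a b hab => ?_⟩
  · simp
  · dsimp only
    rw [hr (a := ⊤) (hC a) (hC a).top_mem]
    refine Set.ncard_le_ncard ?_ (Set.toFinite _)
    rintro x ⟨hx, hxa⟩
    exact ⟨hx, lt_of_lt_of_le hxa le_top⟩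
  · obtain ⟨D, hD, hsub⟩ := exists_isMaxChain_superset (IsChain.pair (r := (· ≤ ·)) hab.le)
    have ha : a ∈ D := hsub (by simp)
    have hb : b ∈ D := hsub (by simp)
    dsimp only
    rw [hr hD ha, hr hD hb]
    have : D ∩ Set.Iio b = insert a (D ∩ Set.Iio a) := by
      ext x
      constructor
      · rintro ⟨hx, hxb⟩
        rcases hD.1.total hx ha with hxa | hxa
        · rcases hxa.eq_or_lt with rfl | hxa
          · exact Or.inl rfl
          · exact Or.inr ⟨hx, hxa⟩
        · rcases hab.eq_or_eq hxa (Set.mem_Iio.1 hxb).le with rfl | rfl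
          · exact Or.inl rfl
          · exact absurd hxb (lt_irrefl _)
      · rintro (rfl | ⟨hx, hxa⟩)
        · exact ⟨ha, hab.lt⟩
        · exact ⟨hx, (Set.mem_Iio.1 hxa).trans hab.lt⟩
    rw [this, Set.ncard_insert_of_notMem (by simp) (Set.toFinite _)]

end Rank

/-! ### Faces of convex hulls, linear independence, and a strictly convex form -/

section ConvexGeometry

variable {ι : Type v}

theorem convexHull_inter_eq_convexHull {E : Set (ι → ℝ)} (l : (ι → ℝ) →L[ℝ] ℝ) {M : ℝ}
    (h : ∀ x ∈ E, l x ≤ M) :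
    {x ∈ convexHull ℝ E | l x = M} = convexHull ℝ {x ∈ E | l x = M} := by
  -- This set contains `E`, so its convexity bounds the hull: a proper convex combination reaches
  -- `M` only if both endpoints do.
  have hconv : Convex ℝ {x | l x ≤ M ∧ (l x = M → x ∈ convexHull ℝ {x ∈ E | l x = M})} := by
    rw [convex_iff_forall_pos]
    rintro x ⟨hx, hx'⟩ y ⟨hy, hy'⟩ a b ha hb hab
    have hle : a * l x + b * l y ≤ M := by
      have h1 := mul_le_mul_of_nonneg_left hx ha.le
      have h2 := mul_le_mul_of_nonneg_left hy hb.le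
      have h3 : a * M + b * M = M := by rw [← add_mul, hab, one_mul]
      linarith
    refine ⟨by simpa using hle, fun hM => ?_⟩
    have hM' : a * l x + b * l y = M := by simpa using hM
    have h3 : a * M + b * M = M := by rw [← add_mul, hab, one_mul]
    have hxM : l x = M := by
      refine le_antisymm hx (not_lt.1 fun hlt => ?_)
      have h1 := mul_lt_mul_of_pos_left hlt ha
      have h2 := mul_le_mul_of_nonneg_left hy hb.le
      linarith
    have hyM : l y = M := by
      refine le_antisymm hy (not_lt.1 fun hlt => ?_)
      have h1 := mul_lt_mul_of_pos_left hlt hb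
      have h2 := mul_le_mul_of_nonneg_left hx ha.le
      linarith
    exact convex_convexHull ℝ _ (hx' hxM) (hy' hyM) ha.le hb.le hab
  apply Set.Subset.antisymm
  · rintro x ⟨hx, hxM⟩
    have := convexHull_min (s := E) (fun y hy => Set.mem_ofPred.2
      ⟨h y hy, fun hyM => subset_convexHull ℝ _ ⟨hy, hyM⟩⟩) hconv hx
    exact this.2 hxM
  · intro x hx
    refine ⟨convexHull_mono (Set.sep_subset _ _) hx, ?_⟩
    have hc : Convex ℝ {x | l x = M} := by
      simpa using convex_hyperplane (𝕜 := ℝ) l.toLinearMap.isLinear M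
    exact convexHull_min (fun y hy => hy.2) hc hx

theorem le_of_mem_convexHull {E : Set (ι → ℝ)} (l : (ι → ℝ) →L[ℝ] ℝ) {M : ℝ}
    (h : ∀ x ∈ E, l x ≤ M) {x : ι → ℝ} (hx : x ∈ convexHull ℝ E) : l x ≤ M :=
  convexHull_min h (convex_halfSpace_le l.toLinearMap.isLinear M) hx

theorem setOf_isMax_convexHull {E : Set (ι → ℝ)} (l : (ι → ℝ) →L[ℝ] ℝ) {M : ℝ}
    (h : ∀ x ∈ E, l x ≤ M) (hne : {x ∈ E | l x = M}.Nonempty) :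
    {x ∈ convexHull ℝ E | ∀ y ∈ convexHull ℝ E, l y ≤ l x} = convexHull ℝ {x ∈ E | l x = M} := by
  rw [← convexHull_inter_eq_convexHull l h]
  obtain ⟨z, hz, hzM⟩ := hne
  ext x
  constructor
  · rintro ⟨hx, hmax⟩
    exact ⟨hx, le_antisymm (le_of_mem_convexHull l h hx) (hzM ▸ hmax z (subset_convexHull ℝ _ hz))⟩
  · rintro ⟨hx, hxM⟩
    exact ⟨hx, fun y hy => hxM ▸ le_of_mem_convexHull l h hy⟩

theorem dimension_convexHull (s : Set (ι → ℝ)) :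
    dimension (convexHull ℝ s) = Module.finrank ℝ (vectorSpan ℝ s) := by
  rw [dimension, ← direction_affineSpan, affineSpan_convexHull, direction_affineSpan]

/-- The differences lie in the kernel of `l`, and any `t ∈ T` lies outside it, so `t` contributes
exactly one dimension. -/
theorem finrank_span_eq_finrank_vectorSpan_add_one [Finite ι] {T : Set (ι → ℝ)} (hT : T.Nonempty)
    (l : (ι → ℝ) →L[ℝ] ℝ) {M : ℝ} (hM : M ≠ 0) (hl : ∀ x ∈ T, l x = M) :
    Module.finrank ℝ (Submodule.span ℝ T) = Module.finrank ℝ (vectorSpan ℝ T) + 1 := by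
  obtain ⟨t, ht⟩ := hT
  have ht0 : t ≠ 0 := by
    rintro rfl
    exact hM (by simpa using (hl 0 ht).symm)
  have hker : vectorSpan ℝ T ≤ LinearMap.ker l.toLinearMap := by
    rw [vectorSpan_def, Submodule.span_le]
    rintro x ⟨a, ha, b, hb, rfl⟩
    simp [hl a ha, hl b hb]
  have hsup : Submodule.span ℝ T = vectorSpan ℝ T ⊔ Submodule.span ℝ {t} := by
    apply le_antisymm
    · rw [Submodule.span_le]
      intro x hx
      have : x = (x - t) + t := by simp
      rw [this]
      exact Submodule.add_mem_sup (vsub_mem_vectorSpan ℝ hx ht) (Submodule.mem_span_singleton_self t)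
    · rw [sup_le_iff, vectorSpan_def, Submodule.span_le, Submodule.span_singleton_le_iff_mem]
      refine ⟨?_, Submodule.subset_span ht⟩
      rintro x ⟨a, ha, b, hb, rfl⟩
      exact Submodule.sub_mem _ (Submodule.subset_span ha) (Submodule.subset_span hb)
  have hinf : vectorSpan ℝ T ⊓ Submodule.span ℝ {t} = ⊥ := by
    rw [eq_bot_iff]
    rintro x ⟨hx, hx'⟩
    obtain ⟨c, rfl⟩ := Submodule.mem_span_singleton.1 hx'
    have h0 : l (c • t) = 0 := hker hx
    rw [map_smul, hl t ht, smul_eq_mul, mul_eq_zero] at h0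
    simp [h0.resolve_right hM]
  have := Submodule.finrank_sup_add_finrank_inf_eq (vectorSpan ℝ T) (Submodule.span ℝ {t})
  rw [hinf, ← hsup, finrank_span_singleton ht0, finrank_bot] at this
  simpa using this

theorem linearIndependent_of_affineIndependent_of_eq {κ : Type*} [Finite ι] {v : κ → ι → ℝ}
    (hv : AffineIndependent ℝ v) (l : (ι → ℝ) →L[ℝ] ℝ) {M : ℝ} (hM : M ≠ 0)
    (hl : ∀ i, l (v i) = M) : LinearIndependent ℝ v := by
  rw [linearIndependent_iff']
  intro s g hg i hi
  have h0 : ∑ j ∈ s, g j = 0 := by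
    have := congrArg l hg
    simp only [map_sum, map_smul, hl, smul_eq_mul, map_zero, ← Finset.sum_mul] at this
    exact (mul_eq_zero.1 this).resolve_right hM
  exact (affineIndependent_iff.1 hv) s g h0 hg i hi

theorem linearIndependent_of_dual {K V κ : Type*} [Field K] [AddCommGroup V] [Module K V]
    {v : κ → V} (h : ∀ i, ∃ f : V →ₗ[K] K, f (v i) ≠ 0 ∧ ∀ j, j ≠ i → f (v j) = 0) :
    LinearIndependent K v := by
  rw [linearIndependent_iff']
  intro s g hg i hi
  obtain ⟨f, hfi, hfj⟩ := h i
  have := congrArg f hg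
  rw [map_sum, Finset.sum_eq_single i, map_smul, map_zero, smul_eq_mul] at this
  · exact (mul_eq_zero.1 this).resolve_right hfi
  · intro j _ hj
    rw [map_smul, hfj j hj, smul_zero]
  · exact fun h => absurd hi h

theorem exists_dual_eq_of_linearIndependent {K V κ : Type*} [Field K] [AddCommGroup V] [Module K V]
    {v : κ → V} (h : LinearIndependent K v) (c : κ → K) : ∃ f : V →ₗ[K] K, ∀ i, f (v i) = c i := by
  obtain ⟨f, hf⟩ := ((Module.Basis.span h).constr K c).exists_extend
  refine ⟨f, fun i => ?_⟩
  have h1 : f (Module.Basis.span h i) = c i := by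
    have h2 := LinearMap.congr_fun hf (Module.Basis.span h i)
    rwa [Module.Basis.constr_basis] at h2
  rwa [Module.Basis.span_apply] at h1

variable [Fintype ι]

/-- A positive definite quadratic form that takes the value `2` at all roots of type `A`. -/
def rootForm (x : ι → ℝ) : ℝ := ∑ i, x i ^ 2 + (∑ i, x i) ^ 2

theorem rootForm_combo (x y : ι → ℝ) {a b : ℝ} (hab : a + b = 1) :
    rootForm (a • x + b • y) = a * rootForm x + b * rootForm y - a * b * rootForm (x - y) := by
  obtain rfl : b = 1 - a := by linarith
  have h1 : ∑ i, (a • x + (1 - a) • y) i ^ 2 =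
      a * ∑ i, x i ^ 2 + (1 - a) * ∑ i, y i ^ 2 - a * (1 - a) * ∑ i, (x - y) i ^ 2 := by
    simp only [Finset.mul_sum, ← Finset.sum_add_distrib, ← Finset.sum_sub_distrib]
    refine Finset.sum_congr rfl fun i _ => ?_
    simp only [Pi.add_apply, Pi.smul_apply, smul_eq_mul, Pi.sub_apply]
    ring
  have h2 : ∑ i, (a • x + (1 - a) • y) i = a * ∑ i, x i + (1 - a) * ∑ i, y i := by
    simp [Finset.mul_sum, Finset.sum_add_distrib]
  have h3 : ∑ i, (x - y) i = ∑ i, x i - ∑ i, y i := by simp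
  simp only [rootForm]
  rw [h1, h2, h3]
  ring

theorem rootForm_nonneg (x : ι → ℝ) : 0 ≤ rootForm x :=
  add_nonneg (Finset.sum_nonneg fun _ _ => sq_nonneg _) (sq_nonneg _)

theorem eq_zero_of_rootForm_nonpos {x : ι → ℝ} (h : rootForm x ≤ 0) : x = 0 := by
  have h1 : ∑ i, x i ^ 2 ≤ 0 := by
    have := sq_nonneg (∑ i, x i)
    rw [rootForm] at h
    linarith
  have h2 := (Finset.sum_eq_zero_iff_of_nonneg (fun i _ => sq_nonneg (x i))).1
    (le_antisymm h1 (Finset.sum_nonneg fun _ _ => sq_nonneg _))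
  funext i
  simpa using h2 i (Finset.mem_univ i)

/-- Points on a sphere of a positive definite form are extreme: the hull lies in the ball, and a
proper segment within the ball has interior points of strictly smaller value. -/
theorem mem_extremePoints_of_rootForm {E : Set (ι → ℝ)} {c : ℝ} (h : ∀ x ∈ E, rootForm x = c) :
    E ⊆ (convexHull ℝ E).extremePoints ℝ := by
  have hle : ∀ x ∈ convexHull ℝ E, rootForm x ≤ c := by
    have hc : Convex ℝ {x : ι → ℝ | rootForm x ≤ c} := by
      intro x hx y hy a b ha hb hab
      have h1 := mul_le_mul_of_nonneg_left (Set.mem_ofPred.1 hx) ha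
      have h2 := mul_le_mul_of_nonneg_left (Set.mem_ofPred.1 hy) hb
      have h3 : a * c + b * c = c := by rw [← add_mul, hab, one_mul]
      have h4 := mul_nonneg (mul_nonneg ha hb) (rootForm_nonneg (x - y))
      change rootForm _ ≤ c
      rw [rootForm_combo x y hab]
      linarith
    exact fun x hx => convexHull_min (fun y hy => (h y hy).le) hc hx
  intro x hx
  rw [mem_extremePoints_iff_left]
  refine ⟨subset_convexHull ℝ _ hx, fun y hy z hz hyz => ?_⟩
  obtain ⟨a, b, ha, hb, hab, rfl⟩ := hyz
  have h1 := h _ hx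
  rw [rootForm_combo y z hab] at h1
  have h2 := mul_le_mul_of_nonneg_left (hle y hy) ha.le
  have h3 := mul_le_mul_of_nonneg_left (hle z hz) hb.le
  have h4 : a * c + b * c = c := by rw [← add_mul, hab, one_mul]
  have h5 : a * b * rootForm (y - z) ≤ 0 := by linarith
  have h6 : rootForm (y - z) ≤ 0 := by
    by_contra h7
    have := mul_pos (mul_pos ha hb) (not_le.1 h7)
    linarith
  obtain rfl := sub_eq_zero.1 (eq_zero_of_rootForm_nonpos h6)
  rw [← add_smul, hab, one_smul]

end ConvexGeometry

/-! ### Edge vectors and potentials -/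

section Edges

variable {P : Type u} [PartialOrder P]

omit [PartialOrder P] in
@[simp] theorem unitVec_bot : unitVec (⊥ : Hat P) = 0 := by
  funext y
  simp [unitVec]

omit [PartialOrder P] in
@[simp] theorem unitVec_top : unitVec (⊤ : Hat P) = 0 := by
  classical
  funext y
  exact if_neg (toHat_ne_top y).symm

omit [PartialOrder P] in
theorem unitVec_toHat [DecidableEq P] (x : P) : unitVec (toHat x) = Pi.single x 1 := by
  classical
  funext y
  simp [unitVec, toHat, Pi.single_apply, eq_comm]

variable (P) in
/-- The vectors `ρ(e)` of all edges `e` of the Hasse diagram of `P̂`. -/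
def edgeVectors : Set (P → ℝ) := {x | ∃ a b : Hat P, a ⋖ b ∧ x = rho a b}

theorem rho_mem {a b : Hat P} (h : a ⋖ b) : rho a b ∈ edgeVectors P := ⟨a, b, h, rfl⟩

theorem finite_edgeVectors [Finite P] : (edgeVectors P).Finite := by
  refine (Set.finite_range (fun p : Hat P × Hat P => rho p.1 p.2)).subset ?_
  rintro x ⟨a, b, -, rfl⟩
  exact ⟨(a, b), rfl⟩

theorem edgeVectors_nonempty [Finite P] : (edgeVectors P).Nonempty := by
  obtain ⟨y, hy, -⟩ := exists_covBy_le_of_lt (bot_ne_top_hat (P := P)).symm.bot_lt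
  exact ⟨_, rho_mem hy⟩

theorem not_bot_covBy_top [Nonempty P] : ¬ (⊥ : Hat P) ⋖ ⊤ := by
  obtain ⟨x⟩ := ‹Nonempty P›
  intro h
  rcases h.eq_or_eq (c := toHat x) bot_le le_top with h | h <;> simp at h

/-- Nonemptiness excludes the edge `⊥ ⋖ ⊤`, whose vector is 0. -/
theorem rootForm_rho [Fintype P] [Nonempty P] {a b : Hat P} (h : a ⋖ b) : rootForm (rho a b) = 2 := by
  classical
  have h1 : ∀ x : P, ∑ i, (Pi.single x (1 : ℝ) : P → ℝ) i = 1 := by simp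
  have h2 : ∀ x : P, ∑ i, ((Pi.single x (1 : ℝ) : P → ℝ) i) ^ 2 = 1 := by
    simp [Pi.single_apply]
  rcases hat_cases a with rfl | rfl | ⟨a, rfl⟩ <;> rcases hat_cases b with rfl | rfl | ⟨b, rfl⟩
  · exact absurd h.lt (lt_irrefl _)
  · exact absurd h not_bot_covBy_top
  · simp only [rho, rootForm, unitVec_bot, unitVec_toHat, zero_sub, Pi.neg_apply, neg_sq,
      Finset.sum_neg_distrib, h1, h2]
    norm_num
  · exact absurd h.lt not_top_lt
  · exact absurd h.lt not_top_lt
  · exact absurd h.lt not_top_lt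
  · exact absurd h.lt not_lt_bot
  · simp only [rho, rootForm, unitVec_top, unitVec_toHat, sub_zero, h1, h2]
    norm_num
  · have hab : a ≠ b := by
      rintro rfl
      exact h.lt.false
    have h3 : ∀ i, (Pi.single a (1 : ℝ) - Pi.single b (1 : ℝ) : P → ℝ) i ^ 2 =
        (Pi.single a (1 : ℝ) : P → ℝ) i ^ 2 + (Pi.single b (1 : ℝ) : P → ℝ) i ^ 2 := by
      intro i
      simp only [Pi.sub_apply, Pi.single_apply]
      split_ifs with h1 h2
      · exact absurd (h1.symm.trans h2) hab
      all_goals norm_num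
    simp only [rho, rootForm, unitVec_toHat, h3, Finset.sum_add_distrib, h2]
    simp only [Pi.sub_apply, Finset.sum_sub_distrib, h1]
    norm_num

variable [Fintype P]

theorem edgeVectors_subset_vertices [Nonempty P] : edgeVectors P ⊆ vertices (polytope P) := by
  refine mem_extremePoints_of_rootForm (c := 2) ?_
  rintro x ⟨a, b, h, rfl⟩
  exact rootForm_rho h

/-- The linear functional with prescribed values at the unit vectors. -/
noncomputable def potential (h : Hat P → ℝ) : (P → ℝ) →L[ℝ] ℝ :=
  LinearMap.toContinuousLinearMap (∑ v, h (toHat v) • LinearMap.proj v)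

omit [PartialOrder P] in
theorem potential_unitVec {h : Hat P → ℝ} (hb : h ⊥ = 0) (ht : h ⊤ = 0) (a : Hat P) :
    potential h (unitVec a) = h a := by
  classical
  rcases hat_cases a with rfl | rfl | ⟨x, rfl⟩
  · simp [hb]
  · simp [ht]
  · simp [potential, unitVec_toHat, Pi.single_apply]

omit [PartialOrder P] in
theorem potential_rho {h : Hat P → ℝ} (hb : h ⊥ = 0) (ht : h ⊤ = 0) (a b : Hat P) :
    potential h (rho a b) = h a - h b := by
  rw [rho, map_sub, potential_unitVec hb ht, potential_unitVec hb ht]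

omit [PartialOrder P] in
theorem functional_ext {f : (P → ℝ) →L[ℝ] ℝ} (h : ∀ x : P, f (unitVec (toHat x)) = 0) : f = 0 := by
  classical
  apply ContinuousLinearMap.coe_injective
  refine LinearMap.pi_ext' fun x => LinearMap.ext_ring ?_
  simpa [unitVec_toHat] using h x

/-- No nonzero functional is nonpositive at all edge vectors. -/
theorem eq_zero_of_nonpos_on_edgeVectors {f : (P → ℝ) →L[ℝ] ℝ} (h : ∀ x ∈ edgeVectors P, f x ≤ 0) :
    f = 0 := by
  have hmono : ∀ a b : Hat P, a ⋖ b → f (unitVec a) ≤ f (unitVec b) := by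
    intro a b hab
    have := h _ (rho_mem hab)
    rw [rho, map_sub] at this
    linarith
  refine functional_ext fun x => le_antisymm ?_ ?_
  · exact induction_down (a := (⊥ : Hat P)) (p := fun a => f (unitVec a) ≤ 0) (by simp)
      (fun a b _ hab hb => (hmono a b hab).trans hb) _ bot_le
  · exact induction_up (a := (⊤ : Hat P)) (p := fun a => 0 ≤ f (unitVec a)) (by simp)
      (fun a b _ hab hb => hb.trans (hmono a b hab)) _ le_top

theorem exists_pos_on_edgeVectors {f : (P → ℝ) →L[ℝ] ℝ} (hf : f ≠ 0) :
    ∃ x ∈ edgeVectors P, 0 < f x := by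
  by_contra! h
  exact hf (eq_zero_of_nonpos_on_edgeVectors h)

end Edges

/-! ### Supporting functionals, facets, and the Fano property -/

section Faces

variable {P : Type u} [PartialOrder P] [Fintype P]

theorem isProperFace_convexHull {l : (P → ℝ) →L[ℝ] ℝ} {M : ℝ} (hM : 0 < M)
    (hl : ∀ x ∈ edgeVectors P, l x ≤ M) (hne : {x ∈ edgeVectors P | l x = M}.Nonempty) :
    IsProperFace (polytope P) (convexHull ℝ {x ∈ edgeVectors P | l x = M}) := by
  refine ⟨fun _ => ⟨l, (setOf_isMax_convexHull l hl hne).symm⟩, hne.convexHull, fun h => ?_⟩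
  rw [← convexHull_inter_eq_convexHull l hl] at h
  have h0 : -l = 0 := eq_zero_of_nonpos_on_edgeVectors fun x hx => by
    have h1 : x ∈ {x ∈ convexHull ℝ (edgeVectors P) | l x = M} := h ▸ subset_convexHull ℝ _ hx
    have h2 := h1.2
    change -(l x) ≤ 0
    linarith
  obtain ⟨x, -, hx⟩ := hne
  rw [neg_eq_zero.1 h0] at hx
  exact hM.ne hx

theorem IsProperFace.exists_functional {F : Set (P → ℝ)} (hF : IsProperFace (polytope P) F) :
    ∃ (l : (P → ℝ) →L[ℝ] ℝ) (M : ℝ), 0 < M ∧ (∀ x ∈ edgeVectors P, l x ≤ M) ∧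
      {x ∈ edgeVectors P | l x = M}.Nonempty ∧
      F = convexHull ℝ {x ∈ edgeVectors P | l x = M} := by
  obtain ⟨hexp, ⟨z, hz⟩, hne⟩ := hF
  obtain ⟨l, rfl⟩ := hexp ⟨z, hz⟩
  have hl : ∀ x ∈ edgeVectors P, l x ≤ l z := fun x hx => hz.2 x (subset_convexHull ℝ _ hx)
  have hT : {x ∈ edgeVectors P | l x = l z}.Nonempty := by
    rw [← convexHull_nonempty_iff (𝕜 := ℝ), ← convexHull_inter_eq_convexHull l hl]
    exact ⟨z, hz.1, rfl⟩
  -- A maximum `≤ 0` would force `l = 0`, and the face would be the whole polytope.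
  refine ⟨l, l z, not_le.1 fun h => hne ?_, hl, hT, setOf_isMax_convexHull l hl hT⟩
  have h0 : l = 0 := eq_zero_of_nonpos_on_edgeVectors fun x hx => (hl x hx).trans h
  simp [h0]

theorem vertices_convexHull_tight [Nonempty P] (l : (P → ℝ) →L[ℝ] ℝ) (M : ℝ) :
    vertices (convexHull ℝ {x ∈ edgeVectors P | l x = M}) = {x ∈ edgeVectors P | l x = M} := by
  refine Set.Subset.antisymm extremePoints_convexHull_subset fun x hx => ?_
  exact inter_extremePoints_subset_extremePoints_of_subset
    (convexHull_mono (Set.sep_subset _ _)) ⟨subset_convexHull ℝ _ hx, edgeVectors_subset_vertices hx.1⟩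

theorem zero_mem_polytope : (0 : P → ℝ) ∈ polytope P := by
  by_contra h
  obtain ⟨f, u, hu, hf⟩ := geometric_hahn_banach_point_closed (convex_convexHull ℝ (edgeVectors P))
    (finite_edgeVectors.isClosed_convexHull ℝ) h
  rw [map_zero] at hu
  have h0 : -f = 0 := eq_zero_of_nonpos_on_edgeVectors fun x hx => by
    have := hf x (subset_convexHull ℝ _ hx)
    change -(f x) ≤ 0
    linarith
  obtain ⟨x, hx⟩ := edgeVectors_nonempty (P := P)
  have := hf x (subset_convexHull ℝ _ hx)
  rw [neg_eq_zero.1 h0] at this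
  exact absurd this (not_lt.2 hu.le)

omit [PartialOrder P] in
theorem exists_functional_of_ne_top {W : Submodule ℝ (P → ℝ)} (hW : W ≠ ⊤) :
    ∃ f : (P → ℝ) →L[ℝ] ℝ, f ≠ 0 ∧ ∀ x ∈ W, f x = 0 := by
  obtain ⟨f, hf, hW⟩ := Submodule.exists_le_ker_of_lt_top W hW.lt_top
  refine ⟨LinearMap.toContinuousLinearMap f, fun h => hf ?_, fun x hx => hW hx⟩
  exact LinearMap.ext fun x => congrArg (fun g : (P → ℝ) →L[ℝ] ℝ => g x) h

theorem vectorSpan_polytope : vectorSpan ℝ (polytope P) = ⊤ := by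
  by_contra h
  obtain ⟨f, hf, hW⟩ := exists_functional_of_ne_top h
  obtain ⟨x, hx, hpos⟩ := exists_pos_on_edgeVectors hf
  have := hW _ (vsub_mem_vectorSpan ℝ (subset_convexHull ℝ _ hx) zero_mem_polytope)
  simp only [vsub_eq_sub, sub_zero] at this
  exact hpos.ne' this

theorem dimension_polytope : dimension (polytope P) = Fintype.card P := by
  rw [dimension, vectorSpan_polytope, finrank_top, Module.finrank_fintype_fun_eq_card]

theorem zero_mem_interior_polytope : (0 : P → ℝ) ∈ interior (polytope P) := by
  have hconv : Convex ℝ (polytope P) := convex_convexHull ℝ _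
  have hint : (interior (polytope P)).Nonempty := by
    rw [hconv.interior_nonempty_iff_affineSpan_eq_top,
      AffineSubspace.affineSpan_eq_top_iff_vectorSpan_eq_top_of_nonempty _ _ _
        ⟨0, zero_mem_polytope⟩]
    exact vectorSpan_polytope
  by_contra h
  obtain ⟨f, hf⟩ := geometric_hahn_banach_open_point hconv.interior isOpen_interior h
  have hclosed : polytope P ⊆ closure (interior (polytope P)) := by
    rw [hconv.closure_interior_eq_closure_of_nonempty_interior hint]
    exact subset_closure
  have h0 : f = 0 := eq_zero_of_nonpos_on_edgeVectors fun x hx => by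
    have h1 := hclosed (subset_convexHull ℝ _ hx)
    refine closure_minimal (t := {x | f x ≤ 0}) (fun y hy => ?_)
      (isClosed_le f.continuous continuous_const) h1
    simpa using (hf y hy).le
  obtain ⟨y, hy⟩ := hint
  simpa [h0] using hf y hy

omit [Fintype P] [PartialOrder P] in
theorem abs_rho_le_one (a b : Hat P) (i : P) : |rho a b i| ≤ 1 := by
  simp only [rho, unitVec, Pi.sub_apply]
  split_ifs <;> norm_num

omit [Fintype P] [PartialOrder P] in
theorem isIntegerPoint_rho (a b : Hat P) : IsIntegerPoint (rho a b) := by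
  classical
  refine ⟨fun y => (if a = toHat y then 1 else 0) - (if b = toHat y then 1 else 0), ?_⟩
  funext y
  simp only [rho, unitVec, Pi.sub_apply, Int.cast_sub, Int.cast_ite, Int.cast_one, Int.cast_zero]
  rfl

theorem polytope_subset_closedBall : polytope P ⊆ Metric.closedBall 0 1 := by
  refine convexHull_min ?_ (convex_closedBall 0 1)
  rintro x ⟨a, b, -, rfl⟩
  rw [mem_closedBall_zero_iff, pi_norm_le_iff_of_nonneg zero_le_one]
  exact abs_rho_le_one a b

theorem isFano_polytope : IsFano (polytope P) := by
  refine ⟨⟨⟨_, finite_edgeVectors, rfl⟩, fun v hv => ?_⟩, dimension_polytope, ?_⟩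
  · obtain ⟨a, b, -, rfl⟩ := extremePoints_convexHull_subset (𝕜 := ℝ) (A := edgeVectors P) hv
    exact isIntegerPoint_rho a b
  · refine Set.eq_singleton_iff_unique_mem.2 ⟨⟨zero_mem_interior_polytope, 0, ?_⟩, ?_⟩
    · funext i
      simp
    · rintro x ⟨hx, z, rfl⟩
      rcases isEmpty_or_nonempty P with hP | hP
      · exact Subsingleton.elim _ _
      -- In the sup norm the unit ball is the cube, so an interior integer point has all coordinates
      -- of absolute value below 1.
      have h1 := interior_mono polytope_subset_closedBall hx
      rw [interior_closedBall _ one_ne_zero, mem_ball_zero_iff, pi_norm_lt_iff one_pos] at h1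
      funext i
      have h2 := h1 i
      rw [Real.norm_eq_abs, ← Int.cast_abs] at h2
      have h3 : |z i| < 1 := by exact_mod_cast h2
      simp [Int.abs_lt_one_iff.1 h3]

theorem dimension_convexHull_tight_add_one_iff {l : (P → ℝ) →L[ℝ] ℝ} {M : ℝ} (hM : 0 < M)
    (hne : {x ∈ edgeVectors P | l x = M}.Nonempty) :
    dimension (convexHull ℝ {x ∈ edgeVectors P | l x = M}) + 1 = dimension (polytope P) ↔
      Submodule.span ℝ {x ∈ edgeVectors P | l x = M} = ⊤ := by
  rw [dimension_polytope, dimension_convexHull,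
    ← finrank_span_eq_finrank_vectorSpan_add_one hne l hM.ne' (fun x hx => hx.2),
    ← Module.finrank_fintype_fun_eq_card ℝ]
  constructor
  · exact Submodule.eq_top_of_finrank_eq
  · intro h
    rw [h, finrank_top]

/-- Tilt `l` in the direction `g`: old tight edges stay tight, and the smallest ratio `(1 - l x) / g
x` over edges with `g x > 0` is the moment when a first new edge becomes tight. -/
theorem exists_tight_insert {l g : (P → ℝ) →L[ℝ] ℝ} (hl : ∀ x ∈ edgeVectors P, l x ≤ 1)
    (hg : g ≠ 0) (hgl : ∀ x ∈ edgeVectors P, l x = 1 → g x = 0) :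
    ∃ l' : (P → ℝ) →L[ℝ] ℝ, (∀ x ∈ edgeVectors P, l' x ≤ 1) ∧
      {x ∈ edgeVectors P | l x = 1} ⊂ {x ∈ edgeVectors P | l' x = 1} := by
  obtain ⟨x₀, hx₀, hpos₀⟩ := exists_pos_on_edgeVectors hg
  obtain ⟨x₁, ⟨hx₁, hpos₁⟩, hmin⟩ := Set.exists_min_image {x ∈ edgeVectors P | 0 < g x}
    (fun x => (1 - l x) / g x) (finite_edgeVectors.subset (Set.sep_subset _ _)) ⟨x₀, hx₀, hpos₀⟩
  have ht : 0 ≤ (1 - l x₁) / g x₁ := div_nonneg (sub_nonneg.2 (hl x₁ hx₁)) hpos₁.le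
  set t := (1 - l x₁) / g x₁ with ht_def
  have happ : ∀ x, (l + t • g) x = l x + t * g x := fun x => rfl
  refine ⟨l + t • g, fun x hx => ?_, ?_, ?_⟩
  · rw [happ]
    rcases le_or_gt (g x) 0 with h | h
    · have := mul_nonpos_of_nonneg_of_nonpos ht h
      linarith [hl x hx]
    · have := (le_div_iff₀ h).1 (hmin x ⟨hx, h⟩)
      linarith
  · rintro x ⟨hx, hx1⟩
    exact ⟨hx, by rw [happ, hgl x hx hx1, hx1, mul_zero, add_zero]⟩
  · intro h
    have h1 : x₁ ∈ {x ∈ edgeVectors P | (l + t • g) x = 1} := by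
      refine ⟨hx₁, ?_⟩
      rw [happ, ht_def, div_mul_cancel₀ _ hpos₁.ne']
      ring
    have h2 := hgl x₁ hx₁ (h h1).2
    exact hpos₁.ne' h2

/-- The tight set of a supporting functional is contained in a spanning one: every face lies in a
facet. -/
theorem exists_spanning_tight {l : (P → ℝ) →L[ℝ] ℝ} (hl : ∀ x ∈ edgeVectors P, l x ≤ 1) :
    ∃ l' : (P → ℝ) →L[ℝ] ℝ, (∀ x ∈ edgeVectors P, l' x ≤ 1) ∧
      {x ∈ edgeVectors P | l x = 1} ⊆ {x ∈ edgeVectors P | l' x = 1} ∧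
      Submodule.span ℝ {x ∈ edgeVectors P | l' x = 1} = ⊤ := by
  let S : Set (Set (P → ℝ)) := {T | ∃ l' : (P → ℝ) →L[ℝ] ℝ, (∀ x ∈ edgeVectors P, l' x ≤ 1) ∧
    {x ∈ edgeVectors P | l x = 1} ⊆ T ∧ T = {x ∈ edgeVectors P | l' x = 1}}
  have hS : S.Finite := by
    refine (finite_edgeVectors (P := P)).finite_subsets.subset ?_
    rintro T ⟨l', -, -, rfl⟩
    exact Set.sep_subset _ _
  obtain ⟨T, ⟨l', hl', hsub, rfl⟩, hmax⟩ := hS.exists_maximal ⟨_, l, hl, subset_rfl, rfl⟩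
  refine ⟨l', hl', hsub, ?_⟩
  by_contra h
  obtain ⟨g, hg, hg0⟩ := exists_functional_of_ne_top h
  obtain ⟨l'', hl'', hss⟩ := exists_tight_insert hl' hg
    fun x hx hx1 => hg0 x (Submodule.subset_span ⟨hx, hx1⟩)
  exact hss.2 (hmax ⟨l'', hl'', hsub.trans hss.1, rfl⟩ hss.1)

/-- If all facets have linearly independent vertices, then the edge vectors that are tight for a
supporting functional are linearly independent. -/
theorem linearIndependent_tight [Nonempty P]
    (h : ∀ F, IsFacet (polytope P) F → LinearIndependent ℝ (fun x : vertices F => (x : P → ℝ)))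
    {l : (P → ℝ) →L[ℝ] ℝ} (hl : ∀ x ∈ edgeVectors P, l x ≤ 1) :
    LinearIndependent ℝ (fun x : {x ∈ edgeVectors P | l x = 1} => (x : P → ℝ)) := by
  obtain ⟨l', hl', hsub, hspan⟩ := exists_spanning_tight hl
  have hne : {x ∈ edgeVectors P | l' x = 1}.Nonempty := by
    by_contra hne
    rw [Set.not_nonempty_iff_eq_empty.1 hne, Submodule.span_empty] at hspan
    exact absurd hspan bot_ne_top
  have := h _ ⟨isProperFace_convexHull one_pos hl' hne,
    (dimension_convexHull_tight_add_one_iff one_pos hne).2 hspan⟩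
  rw [vertices_convexHull_tight] at this
  exact LinearIndepOn.mono (v := id) this hsub

omit [PartialOrder P] in
theorem IsSimplex.linearIndependent_vertices {F : Set (P → ℝ)} (hF : IsSimplex F)
    (l : (P → ℝ) →L[ℝ] ℝ) {M : ℝ} (hM : M ≠ 0) (hl : ∀ x ∈ vertices F, l x = M) :
    LinearIndependent ℝ (fun x : vertices F => (x : P → ℝ)) := by
  obtain ⟨n, S, rfl⟩ := hF
  have h1 : vertices (convexHull ℝ (Set.range S.points)) ⊆ Set.range S.points :=
    extremePoints_convexHull_subset
  exact linearIndependent_of_affineIndependent_of_eq (S.independent.range.mono h1) l hM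
    fun x => hl x x.2

omit [PartialOrder P] in
-- The unit vectors have integer expansions in `b`, so the real vectors span, and their number
-- equals the dimension.
theorem linearIndependent_of_intBasis (b : Module.Basis P ℤ (P → ℤ)) {V : Set (P → ℝ)}
    (hV : V = Set.range (fun k => (fun i => (b k i : ℝ) : P → ℝ))) :
    LinearIndependent ℝ (fun x : V => (x : P → ℝ)) := by
  classical
  have hspan : ⊤ ≤ Submodule.span ℝ (Set.range (fun k => (fun i => (b k i : ℝ) : P → ℝ))) := by
    rw [← (Pi.basisFun ℝ P).span_eq, Submodule.span_le]
    rintro x ⟨i, rfl⟩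
    have h1 := b.sum_repr (Pi.single i 1)
    have h2 : Pi.basisFun ℝ P i =
        ∑ k, ((b.repr (Pi.single i 1) k : ℤ) : ℝ) • (fun i => (b k i : ℝ) : P → ℝ) := by
      funext j
      have h3 := congrArg (Int.cast : ℤ → ℝ) (congrFun h1 j)
      simp only [Finset.sum_apply, Pi.smul_apply, smul_eq_mul, Int.cast_sum, Int.cast_mul] at h3 ⊢
      rw [h3, Pi.basisFun_apply, Pi.single_apply, Pi.single_apply]
      split_ifs <;> simp
    rw [h2]
    exact Submodule.sum_mem _ fun k _ => Submodule.smul_mem _ _ (Submodule.subset_span ⟨k, rfl⟩)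
  subst hV
  exact (linearIndependent_of_top_le_span_of_card_eq_finrank hspan (by simp)).linearIndepOn_id

end Faces

/-! ### Branching in a graded poset produces dependent tight edges -/

section Graded

variable {P : Type u} [PartialOrder P] [Fintype P]

omit [PartialOrder P] [Fintype P] in
theorem unitVec_apply [DecidableEq (Hat P)] (a : Hat P) (y : P) :
    unitVec a y = if a = toHat y then 1 else 0 := by
  unfold unitVec toHat
  congr

theorem exists_dependent_of_upper_covers {r : Hat P → ℕ} (htop : ∀ a, r a ≤ r ⊤)
    (hr : ∀ a b, a ⋖ b → r b = r a + 1) {x a b : P} (ha : x ⋖ a) (hb : x ⋖ b) (hab : a ≠ b) :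
    ∃ l : (P → ℝ) →L[ℝ] ℝ, (∀ y ∈ edgeVectors P, l y ≤ 1) ∧
      ¬ LinearIndependent ℝ (fun y : {y ∈ edgeVectors P | l y = 1} => (y : P → ℝ)) := by
  classical
  -- Corank drops by 1 along each edge above `x`; an edge entering this up-set from outside gets a
  -- value `≤ 0`.
  let h : Hat P → ℝ := fun v => if toHat x ≤ v then (r ⊤ : ℝ) - r v else 0
  have hbot : h ⊥ = 0 := if_neg (by simp)
  have htop' : h ⊤ = 0 := by simp [h]
  have htight : ∀ v w, toHat x ≤ v → v ⋖ w → potential h (rho v w) = 1 := by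
    intro v w hv hvw
    rw [potential_rho hbot htop']
    simp only [h, if_pos hv, if_pos (hv.trans hvw.le), hr v w hvw]
    push_cast
    ring
  refine ⟨potential h, ?_, fun hli => ?_⟩
  · rintro y ⟨v, w, hvw, rfl⟩
    by_cases hv : toHat x ≤ v
    · exact (htight v w hv hvw).le
    · rw [potential_rho hbot htop']
      have h0 : 0 ≤ h w := by
        simp only [h]
        split_ifs
        · exact sub_nonneg.2 (by exact_mod_cast htop w)
        · exact le_rfl
      have h1 : h v = 0 := if_neg hv
      linarith
  -- Independence would allow `f` to be 1 on the edge from `x` to `a` and 0 on every other edge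
  -- above `x`. Descending from `⊤` gives `f = 0` at `e_a` and `e_b`, so the two edges out of `x`
  -- force `f e_x` to be both 1 and 0.
  · obtain ⟨f, hf⟩ := exists_dual_eq_of_linearIndependent hli
      (fun y => if (y : P → ℝ) = rho (toHat x) (toHat a) then 1 else 0)
    have hf' : ∀ v w, toHat x ≤ v → v ⋖ w →
        f (rho v w) = if rho v w = rho (toHat x) (toHat a) then 1 else 0 :=
      fun v w hv hvw => hf ⟨_, rho_mem hvw, htight v w hv hvw⟩
    have hzero : ∀ c : P, x ⋖ c → f (unitVec (toHat c)) = 0 := by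
      intro c hc
      refine induction_down (p := fun v => f (unitVec v) = 0) (a := toHat c) (by simp) ?_ _ le_rfl
      intro v w hv hvw hw
      have hxv : toHat x < v := lt_of_lt_of_le (toHat_covBy_toHat.2 hc).lt hv
      have h1 := hf' v w hxv.le hvw
      rw [if_neg, rho, map_sub, hw, sub_zero] at h1
      · exact h1
      · intro h2
        have h3 := congrFun h2 x
        simp [rho, unitVec_apply, hxv.ne', (hxv.trans hvw.lt).ne', ha.lt.ne'] at h3
    have h1 := hf' _ _ le_rfl (toHat_covBy_toHat.2 ha)
    have h2 := hf' _ _ le_rfl (toHat_covBy_toHat.2 hb)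
    rw [if_pos rfl, rho, map_sub, hzero a ha] at h1
    rw [if_neg, rho, map_sub, hzero b hb] at h2
    · linarith
    · intro h3
      have h4 := congrFun h3 a
      simp [rho, unitVec_apply, hab.symm, ha.lt.ne] at h4

theorem exists_dependent_of_lower_covers {r : Hat P → ℕ} (hrbot : r ⊥ = 0)
    (hr : ∀ a b, a ⋖ b → r b = r a + 1) {x a b : P} (ha : a ⋖ x) (hb : b ⋖ x) (hab : a ≠ b) :
    ∃ l : (P → ℝ) →L[ℝ] ℝ, (∀ y ∈ edgeVectors P, l y ≤ 1) ∧
      ¬ LinearIndependent ℝ (fun y : {y ∈ edgeVectors P | l y = 1} => (y : P → ℝ)) := by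
  classical
  -- The dual potential: negative rank below `x`, which vanishes at `⊥` because `r ⊥ = 0`.
  let h : Hat P → ℝ := fun v => if v ≤ toHat x then -(r v : ℝ) else 0
  have hbot : h ⊥ = 0 := by simp [h, hrbot]
  have htop' : h ⊤ = 0 := if_neg (by simp)
  have htight : ∀ v w, w ≤ toHat x → v ⋖ w → potential h (rho v w) = 1 := by
    intro v w hw hvw
    rw [potential_rho hbot htop']
    simp only [h, if_pos hw, if_pos (hvw.le.trans hw), hr v w hvw]
    push_cast
    ring
  refine ⟨potential h, ?_, fun hli => ?_⟩
  · rintro y ⟨v, w, hvw, rfl⟩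
    by_cases hw : w ≤ toHat x
    · exact (htight v w hw hvw).le
    · rw [potential_rho hbot htop']
      have h0 : h v ≤ 0 := by
        simp only [h]
        split_ifs <;> simp
      have h1 : h w = 0 := if_neg hw
      linarith
  · obtain ⟨f, hf⟩ := exists_dual_eq_of_linearIndependent hli
      (fun y => if (y : P → ℝ) = rho (toHat a) (toHat x) then 1 else 0)
    have hf' : ∀ v w, w ≤ toHat x → v ⋖ w →
        f (rho v w) = if rho v w = rho (toHat a) (toHat x) then 1 else 0 :=
      fun v w hw hvw => hf ⟨_, rho_mem hvw, htight v w hw hvw⟩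
    have hzero : ∀ c : P, c ⋖ x → f (unitVec (toHat c)) = 0 := by
      intro c hc
      refine induction_up (p := fun v => f (unitVec v) = 0) (a := toHat c) (by simp) ?_ _ le_rfl
      intro v w hw hvw hv
      have hwx : w < toHat x := lt_of_le_of_lt hw (toHat_covBy_toHat.2 hc).lt
      have h1 := hf' v w hwx.le hvw
      rw [if_neg, rho, map_sub, hv, zero_sub, neg_eq_zero] at h1
      · exact h1
      · intro h2
        have h3 := congrFun h2 x
        simp [rho, unitVec_apply, hwx.ne, (hvw.lt.trans hwx).ne, ha.lt.ne] at h3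
    have h1 := hf' _ _ le_rfl (toHat_covBy_toHat.2 ha)
    have h2 := hf' _ _ le_rfl (toHat_covBy_toHat.2 hb)
    rw [if_pos rfl, rho, map_sub, hzero a ha] at h1
    rw [if_neg, rho, map_sub, hzero b hb] at h2
    · linarith
    · intro h3
      have h4 := congrFun h3 a
      simp [rho, unitVec_apply, hab.symm, ha.lt.ne'] at h4

theorem isDisjointUnionOfChains_of_facets [Nonempty P] (hP : IsPure P)
    (h : ∀ F, IsFacet (polytope P) F → LinearIndependent ℝ (fun x : vertices F => (x : P → ℝ))) :
    IsDisjointUnionOfChains P := by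
  obtain ⟨r, hbot, htop, hr⟩ := exists_rank (α := Hat P) hP
  refine isDisjointUnionOfChains_of_cover_unique ?_ ?_
  · intro x a b ha hb
    by_contra hab
    obtain ⟨l, hl, hdep⟩ := exists_dependent_of_upper_covers htop hr ha hb hab
    exact hdep (linearIndependent_tight h hl)
  · intro x a b ha hb
    by_contra hab
    obtain ⟨l, hl, hdep⟩ := exists_dependent_of_lower_covers hbot hr ha hb hab
    exact hdep (linearIndependent_tight h hl)

end Graded

/-! ### Disjoint unions of chains: simplicial and smooth faces -/

section Chains

variable {P : Type u} [PartialOrder P] [Fintype P]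

open Classical in
/-- The functional summing the coordinates in the interval `[b, p]`. -/
noncomputable def intervalSum (b p : P) : (P → ℝ) →L[ℝ] ℝ :=
  potential fun v => if toHat b ≤ v ∧ v ≤ toHat p then 1 else 0

theorem intervalSum_unitVec (b p : P) {v : P} (hb : b ≤ v) (hp : v ≤ p) :
    intervalSum b p (unitVec (toHat v)) = 1 := by
  rw [intervalSum, potential_unitVec] <;> simp [hb, hp]

-- By uniqueness of covers, an edge can cross the boundary of `[b, p]` only by leaving `p` upward or
-- entering `b` from below.
open Classical in
theorem IsDisjointUnionOfChains.intervalSum_rho (hP : IsDisjointUnionOfChains P) {b p : P}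
    (hbp : b ≤ p) {v w : Hat P} (hvw : v ⋖ w) :
    intervalSum b p (rho v w) =
      (if v = toHat p then 1 else 0) - (if w = toHat b then 1 else 0) := by
  rw [intervalSum, potential_rho (by simp) (by simp)]
  have hbp' : toHat b ≤ toHat p := toHat_le_toHat.2 hbp
  by_cases hvp : v = toHat p
  · subst hvp
    rw [if_pos ⟨hbp', le_rfl⟩, if_neg (fun h => (hvw.lt.trans_le h.2).false), if_pos rfl,
      if_neg (fun h => (hvw.lt.trans_le (h.le.trans hbp')).false)]
  by_cases hwb : w = toHat b
  · subst hwb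
    rw [if_neg (fun h => (hvw.lt.trans_le h.1).false), if_pos ⟨le_rfl, hbp'⟩, if_neg hvp, if_pos rfl]
  rw [if_neg hvp, if_neg hwb]
  have hiff : (toHat b ≤ v ∧ v ≤ toHat p) ↔ (toHat b ≤ w ∧ w ≤ toHat p) := by
    constructor
    · rintro ⟨h1, h2⟩
      refine ⟨h1.trans hvw.le, ?_⟩
      obtain ⟨c, hc, hcp⟩ := exists_covBy_le_of_lt (lt_of_le_of_ne h2 hvp)
      obtain ⟨y, rfl⟩ := exists_eq_toHat (a := v)
        (by rintro rfl; simp at h1) (by rintro rfl; simp at h2)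
      rwa [hP.upper_cover_unique hvw hc]
    · rintro ⟨h1, h2⟩
      refine ⟨?_, hvw.le.trans h2⟩
      obtain ⟨c, hcb, hc⟩ := exists_le_covBy_of_lt (lt_of_le_of_ne h1 (Ne.symm hwb))
      obtain ⟨y, rfl⟩ := exists_eq_toHat (a := w)
        (by rintro rfl; simp at h1) (by rintro rfl; simp at h2)
      rwa [hP.lower_cover_unique hvw hc]
  simp only [hiff]
  ring

/-- If all edges above `b` and below `a` had value `M > 0`, the potential would be `≥ 0` at `b` and
`≤ 0` at `a`, contradicting `l (rho a b) = M > 0`. -/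
theorem exists_not_tight {l : (P → ℝ) →L[ℝ] ℝ} {M : ℝ} (hM : 0 < M) {a b : Hat P}
    (hl : l (rho a b) = M) :
    ∃ p q : Hat P, p ⋖ q ∧ l (rho p q) ≠ M ∧ (b ≤ p ∨ q ≤ a) := by
  by_contra! h
  have h1 : 0 ≤ l (unitVec b) := by
    refine induction_down (p := fun v => 0 ≤ l (unitVec v)) (a := b) (by simp) ?_ _ le_rfl
    intro v w hv hvw hw
    by_contra hneg
    refine (h v w hvw ?_).1 hv
    intro heq
    rw [rho, map_sub] at heq
    exact hneg (by linarith)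
  have h2 : l (unitVec a) ≤ 0 := by
    refine induction_up (p := fun v => l (unitVec v) ≤ 0) (a := a) (by simp) ?_ _ le_rfl
    intro v w hw hvw hv
    by_contra hpos
    refine (h v w hvw ?_).2 hw
    intro heq
    rw [rho, map_sub] at heq
    exact hpos (by linarith)
  rw [rho, map_sub] at hl
  linarith

theorem IsDisjointUnionOfChains.linearIndependent_tight (hP : IsDisjointUnionOfChains P)
    (l : (P → ℝ) →L[ℝ] ℝ) {M : ℝ} (hM : 0 < M) :
    LinearIndependent ℝ (fun x : {x ∈ edgeVectors P | l x = M} => (x : P → ℝ)) := by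
  classical
  refine linearIndependent_of_dual ?_
  rintro ⟨_, ⟨a, b, hab, rfl⟩, hx⟩
  -- The interval between the given tight edge and this non-tight one is bounded by exactly these
  -- two edges, so its sum is nonzero on the given edge and 0 on all other tight ones.
  obtain ⟨p, q, hpq, hne, h | h⟩ := exists_not_tight hM hx
  · obtain ⟨b, rfl⟩ := exists_eq_toHat (a := b) (ne_bot_of_gt hab.lt)
      (ne_top_of_lt (h.trans_lt hpq.lt))
    obtain ⟨p, rfl⟩ := exists_eq_toHat (a := p)
      (ne_bot_of_gt (hab.lt.trans_le h)) (ne_top_of_lt hpq.lt)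
    refine ⟨intervalSum b p, ?_, ?_⟩
    · change intervalSum b p (rho a (toHat b)) ≠ 0
      rw [hP.intervalSum_rho (toHat_le_toHat.1 h) hab, if_neg (hab.lt.trans_le h).ne]
      simp
    · rintro ⟨_, ⟨v, w, hvw, rfl⟩, hy⟩ hne'
      change intervalSum b p (rho v w) = 0
      rw [hP.intervalSum_rho (toHat_le_toHat.1 h) hvw, if_neg, if_neg, sub_zero]
      · rintro rfl
        obtain rfl := hP.lower_cover_unique hab hvw
        exact hne' rfl
      · rintro rfl
        obtain rfl := hP.upper_cover_unique hpq hvw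
        exact hne hy
  · obtain ⟨a, rfl⟩ := exists_eq_toHat (a := a) (ne_bot_of_gt (hpq.lt.trans_le h))
      (ne_top_of_lt hab.lt)
    obtain ⟨q, rfl⟩ := exists_eq_toHat (a := q) (ne_bot_of_gt hpq.lt)
      (ne_top_of_lt (h.trans_lt hab.lt))
    refine ⟨intervalSum q a, ?_, ?_⟩
    · change intervalSum q a (rho (toHat a) b) ≠ 0
      rw [hP.intervalSum_rho (toHat_le_toHat.1 h) hab, if_neg (h.trans_lt hab.lt).ne']
      simp
    · rintro ⟨_, ⟨v, w, hvw, rfl⟩, hy⟩ hne'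
      change intervalSum q a (rho v w) = 0
      rw [hP.intervalSum_rho (toHat_le_toHat.1 h) hvw, if_neg, if_neg, sub_zero]
      · rintro rfl
        obtain rfl := hP.lower_cover_unique hpq hvw
        exact hne hy
      · rintro rfl
        obtain rfl := hP.upper_cover_unique hab hvw
        exact hne' rfl

theorem IsDisjointUnionOfChains.isSimplex_of_isProperFace (hP : IsDisjointUnionOfChains P)
    {F : Set (P → ℝ)} (hF : IsProperFace (polytope P) F) : IsSimplex F := by
  obtain ⟨l, M, hM, -, hne, rfl⟩ := hF.exists_functional
  set T := {x ∈ edgeVectors P | l x = M} with hT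
  have hfin : T.Finite := finite_edgeVectors.subset (Set.sep_subset _ _)
  have := hfin.fintype
  have := hne.to_subtype
  have hli : LinearIndependent ℝ (fun x : T => (x : P → ℝ)) := hP.linearIndependent_tight l hM
  obtain ⟨n, hn⟩ := Nat.exists_eq_succ_of_ne_zero (Fintype.card_ne_zero (α := T))
  let e : Fin (n + 1) ≃ T := (Fintype.equivFinOfCardEq hn).symm
  refine ⟨n, ⟨fun i => e i, hli.affineIndependent.comp_embedding e.toEmbedding⟩, ?_⟩
  congr 1
  ext x
  constructor
  · exact fun hx => ⟨e.symm ⟨x, hx⟩, by simp⟩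
  · rintro ⟨i, rfl⟩
    exact (e i).2

theorem IsDisjointUnionOfChains.unitVec_mem_span_int (hP : IsDisjointUnionOfChains P)
    {l : (P → ℝ) →L[ℝ] ℝ} {M : ℝ}
    (hspan : Submodule.span ℝ {x ∈ edgeVectors P | l x = M} = ⊤) (v : P) :
    unitVec (toHat v) ∈ Submodule.span ℤ {x ∈ edgeVectors P | l x = M} := by
  classical
  set W := Submodule.span ℤ {x ∈ edgeVectors P | l x = M} with hW
  -- If all edges above `v` are tight, adding them up along a path to `⊤` gives `e_v`; below `v` a
  -- path gives `-e_v`. Otherwise the interval around `v` between two non-tight edges has a sum that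
  -- kills the spanning tight set but not `e_v`.
  by_cases hup : ∀ p q : Hat P, p ⋖ q → toHat v ≤ p → l (rho p q) = M
  · refine induction_down (p := fun w => unitVec w ∈ W) (a := toHat v) (by simp) ?_ _ le_rfl
    intro p q hp hpq hq
    have h1 : rho p q ∈ W := Submodule.subset_span ⟨rho_mem hpq, hup p q hpq hp⟩
    simpa [rho] using W.add_mem h1 hq
  by_cases hdown : ∀ p q : Hat P, p ⋖ q → q ≤ toHat v → l (rho p q) = M
  · refine induction_up (p := fun w => unitVec w ∈ W) (a := toHat v) (by simp) ?_ _ le_rfl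
    intro p q hq hpq hp
    have h1 : rho p q ∈ W := Submodule.subset_span ⟨rho_mem hpq, hdown p q hpq hq⟩
    simpa [rho] using W.sub_mem hp h1
  push Not at hup hdown
  obtain ⟨p, q, hpq, hp, hne⟩ := hup
  obtain ⟨p', q', hpq', hq', hne'⟩ := hdown
  exfalso
  obtain ⟨p, rfl⟩ := exists_eq_toHat (a := p) (by rintro rfl; simp at hp) (ne_top_of_lt hpq.lt)
  obtain ⟨q', rfl⟩ := exists_eq_toHat (a := q') (ne_bot_of_gt hpq'.lt) (by rintro rfl; simp at hq')
  rw [toHat_le_toHat] at hp hq'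
  have hker : Submodule.span ℝ {x ∈ edgeVectors P | l x = M} ≤
      LinearMap.ker (intervalSum q' p).toLinearMap := by
    rw [Submodule.span_le]
    rintro _ ⟨⟨a, b, hab, rfl⟩, hx⟩
    change intervalSum q' p (rho a b) = 0
    rw [hP.intervalSum_rho (hq'.trans hp) hab, if_neg, if_neg, sub_zero]
    · rintro rfl
      obtain rfl := hP.lower_cover_unique hpq' hab
      exact hne' hx
    · rintro rfl
      obtain rfl := hP.upper_cover_unique hpq hab
      exact hne hx
  rw [hspan] at hker
  have h0 : intervalSum q' p (unitVec (toHat v)) = 0 := hker Submodule.mem_top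
  rw [intervalSum_unitVec q' p hq' hp] at h0
  exact one_ne_zero h0

omit [PartialOrder P] in
/-- Linearly independent integer vectors whose `ℤ`-span contains the unit vectors form a
`ℤ`-basis of `ℤ^P`. -/
theorem exists_intBasis_of_linearIndependent {T : Set (P → ℝ)}
    (hli : LinearIndependent ℝ (fun x : T => (x : P → ℝ))) (hint : ∀ x ∈ T, IsIntegerPoint x)
    (hspan : ∀ v : P, unitVec (toHat v) ∈ Submodule.span ℤ T) :
    ∃ b : Module.Basis P ℤ (P → ℤ), T = Set.range (fun k => (fun i => (b k i : ℝ) : P → ℝ)) := by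
  classical
  let φ : (P → ℤ) →ₗ[ℤ] (P → ℝ) := (Int.castAddHom ℝ).toIntLinearMap.compLeft P
  have hφ : ∀ z, φ z = fun i => (z i : ℝ) := fun z => rfl
  have hφi : Function.Injective φ := by
    intro y z hyz
    funext i
    exact Int.cast_injective (α := ℝ) (congrFun hyz i)
  choose z hz using fun x : T => hint x x.2
  have hzφ : ∀ x : T, φ (z x) = x := fun x => (hz x).symm
  have hli' : LinearIndependent ℤ z := by
    refine LinearIndependent.of_comp φ ?_
    have : φ ∘ z = fun x : T => (x : P → ℝ) := funext hzφ
    rw [this]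
    exact hli.restrict_scalars' ℤ
  have hmap : (Submodule.span ℤ (Set.range z)).map φ = Submodule.span ℤ T := by
    rw [Submodule.map_span, ← Set.range_comp]
    congr 1
    ext x
    constructor
    · rintro ⟨y, rfl⟩
      rw [Function.comp_apply, hzφ]
      exact y.2
    · exact fun hx => ⟨⟨x, hx⟩, hzφ _⟩
  have hsp : ⊤ ≤ Submodule.span ℤ (Set.range z) := by
    rw [← (Pi.basisFun ℤ P).span_eq, Submodule.span_le]
    rintro _ ⟨v, rfl⟩
    have h1 := hspan v
    rw [← hmap] at h1
    obtain ⟨y, hy, hyv⟩ := h1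
    have h2 : y = Pi.basisFun ℤ P v := by
      apply hφi
      rw [hyv, unitVec_toHat, hφ]
      funext i
      simp only [Pi.basisFun_apply, Pi.single_apply]
      split_ifs <;> simp
    exact h2 ▸ hy
  let B := Module.Basis.mk hli' hsp
  let e := B.indexEquiv (Pi.basisFun ℤ P)
  refine ⟨B.reindex e, ?_⟩
  have hB : ∀ k, (fun i => (B.reindex e k i : ℝ)) = (e.symm k : P → ℝ) := by
    intro k
    rw [Module.Basis.reindex_apply, Module.Basis.mk_apply]
    exact (hz _).symm
  ext x
  constructor
  · exact fun hx => ⟨e ⟨x, hx⟩, by simp only [hB, Equiv.symm_apply_apply]⟩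
  · rintro ⟨k, rfl⟩
    simp only [hB]
    exact (e.symm k).2

theorem IsDisjointUnionOfChains.exists_basis_of_isFacet [Nonempty P]
    (hP : IsDisjointUnionOfChains P) {F : Set (P → ℝ)} (hF : IsFacet (polytope P) F) :
    ∃ b : Module.Basis P ℤ (P → ℤ),
      vertices F = Set.range (fun k => (fun i => (b k i : ℝ) : P → ℝ)) := by
  obtain ⟨hF, hdim⟩ := hF
  obtain ⟨l, M, hM, -, hne, rfl⟩ := hF.exists_functional
  rw [dimension_convexHull_tight_add_one_iff hM hne] at hdim
  rw [vertices_convexHull_tight]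
  refine exists_intBasis_of_linearIndependent (hP.linearIndependent_tight l hM) ?_
    (hP.unitVec_mem_span_int hdim)
  rintro _ ⟨⟨a, b, -, rfl⟩, -⟩
  exact isIntegerPoint_rho a b

end Chains

end FanoPoset

theorem mainTheorem2 {P : Type u} [PartialOrder P] [Fintype P] (hP : FanoPoset.IsPure P) :
    List.TFAE [FanoPoset.IsQFactorialFano (FanoPoset.polytope P),
      FanoPoset.IsSmoothFano (FanoPoset.polytope P),
      FanoPoset.IsDisjointUnionOfChains P] := by
  tfae_have 3 → 1 := fun h =>
    ⟨FanoPoset.isFano_polytope, fun _ hF => h.isSimplex_of_isProperFace hF⟩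
  tfae_have 3 → 2 := fun h => by
    refine ⟨FanoPoset.isFano_polytope, fun F hF => ?_⟩
    rcases isEmpty_or_nonempty P with hE | hE
    -- For empty `P` the polytope has dimension 0, hence no facets.
    · have := hF.2
      rw [FanoPoset.dimension_polytope, Fintype.card_eq_zero] at this
      exact absurd this (Nat.succ_ne_zero _)
    · exact h.exists_basis_of_isFacet hF
  tfae_have 1 → 3 := fun h => by
    rcases isEmpty_or_nonempty P with hE | hE
    · exact FanoPoset.isDisjointUnionOfChains_of_cover_unique (fun x => isEmptyElim x)
        (fun x => isEmptyElim x)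
    · refine FanoPoset.isDisjointUnionOfChains_of_facets hP fun F hF => ?_
      obtain ⟨l, M, hM, -, -, hFeq⟩ := hF.1.exists_functional
      refine (h.2 F hF.1).linearIndependent_vertices l hM.ne' fun x hx => ?_
      rw [hFeq, FanoPoset.vertices_convexHull_tight] at hx
      exact hx.2
  tfae_have 2 → 3 := fun h => by
    rcases isEmpty_or_nonempty P with hE | hE
    · exact FanoPoset.isDisjointUnionOfChains_of_cover_unique (fun x => isEmptyElim x)
        (fun x => isEmptyElim x)
    · refine FanoPoset.isDisjointUnionOfChains_of_facets hP fun F hF => ?_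
      obtain ⟨b, hb⟩ := h.2 F hF
      exact FanoPoset.linearIndependent_of_intBasis b hb
  tfae_finish
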